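/- Let $\Gamma$ be a countable amenable group (discrete). For $f\in\mathbb{Z}\Gamma$ let $X_f$ be the Pontryagin dual of the discrete left $\mathbb{Z}\Gamma$-module $\mathbb{Z}\Gamma/\mathbb{Z}\Gamma f$, with the dual action of $\Gamma$ by continuous automorphisms, $(g\chi)(m)=\chi(g^{-1}m)$. Let $X$ be a compact abelian group with a compatible metric $d$, on which $\Gamma$ acts by continuous automorphisms, such that the action is a principal algebraic action, i.e. for some $f\in\mathbb{Z}\Gamma$ it is isomorphic, by a $\Gamma$-equivariant isomorphism of topological groups, to the action of $\Gamma$ on $X_f$. A pair $(x,y)\in X\times X$ is called asymptotic if $\lim_{\Gamma\ni g\to\infty}d(gx,gy)=0$, that is, if for every $\varepsilon>0$ there are only finitely many $g\in\Gamma$ with $d(gx,gy)>\varepsilon$. The homoclinic group is $\Delta(X)=\{x\in X: (x,1)\text{ is asymptotic}\}$. The action is expansive if there is $\eta>0$ such that for all $x\ne y$ in $X$ some $g\in\Gamma$ satisfies $d(gx,gy)>\eta$. The topological entropy of the action is $$h=\sup_{\delta>0}\limsup_{n\to\infty}\frac1{|F_n|}\log \mathrm{sep}_{\delta,F_n},$$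 where $(F_n)$ is any left Følner sequence of $\Gamma$ (nonempty finite sets with $|gF_n\,\triangle\,F_n|/|F_n|\to0$ for every $g\in\Gamma$) and $\mathrm{sep}_{\delta,F}$ is the maximal cardinality of a set $Y\subset X$ with $\max_{g\in F}d(gx,gy)\ge\delta$ for all distinct $x,y\in Y$. If the action is expansive and has positive topological entropy (computed along some left Følner sequence), then there is an asymptotic pair $(x,y)$ with $x\ne y$, and the homoclinic group $\Delta(X)$ is nontrivial. Moreover, these two conclusions are equivalent: whether or not the action is expansive or has positive entropy, a non-diagonal asymptotic pair exists if and only if $\Delta(X)\neq\{1\}$. -/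

import Mathlib

open Filter Topology
open scoped symmDiff

noncomputable section

/-! ### Amenability and Følner sequences -/

open Classical in
/-- The relative size `|gF ∆ F| / |F|` of the boundary of a finite set `F` under left
translation by `g`. -/
def folnerRatio {Γ : Type*} [Group Γ] (g : Γ) (F : Finset Γ) : ℝ :=
  ((F.image (fun h => g * h) ∆ F).card : ℝ) / (F.card : ℝ)

/-- Amenability of a discrete group, in the form of the Følner condition. -/
def IsAmenable (Γ : Type*) [Group Γ] : Prop :=
  ∀ (S : Finset Γ) (ε : ℝ), 0 < ε →
    ∃ F : Finset Γ, F.Nonempty ∧ ∀ s ∈ S, folnerRatio s F ≤ ε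

/-- A left Følner sequence: nonempty finite sets `F n` with `|g F n ∆ F n| / |F n| → 0` for
every `g`. -/
structure IsLeftFolner {Γ : Type*} [Group Γ] (F : ℕ → Finset Γ) : Prop where
  nonempty : ∀ n, (F n).Nonempty
  tendsto_ratio : ∀ g : Γ, Tendsto (fun n => folnerRatio g (F n)) atTop (𝓝 0)

/-! ### Dynamics of group actions on metric spaces -/

/-- The action is expansive: some `η > 0` is an expansive constant. -/
def IsExpansive (Γ X : Type*) [Group Γ] [MetricSpace X] [MulAction Γ X] : Prop :=
  ∃ η : ℝ, 0 < η ∧ ∀ x y : X, x ≠ y → ∃ g : Γ, η < dist (g • x) (g • y)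

/-- `(x, y)` is an asymptotic pair: `d(g x, g y) → 0` as `g → ∞` in the discrete group `Γ`. -/
def IsAsymptoticPair (Γ : Type*) {X : Type*} [Group Γ] [MetricSpace X] [MulAction Γ X]
    (x y : X) : Prop :=
  Tendsto (fun g : Γ => dist (g • x) (g • y)) cofinite (𝓝 0)

/-- The action has an asymptotic pair off the diagonal. -/
def HasOffDiagonalAsymptoticPair (Γ X : Type*) [Group Γ] [MetricSpace X] [MulAction Γ X] :
    Prop :=
  ∃ x y : X, x ≠ y ∧ IsAsymptoticPair Γ x y

/-- `Y` is `(F, δ)`-separated: distinct points of `Y` are moved to distance at least `δ` by some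
element of `F`. -/
def IsFSeparated {Γ X : Type*} [Group Γ] [MetricSpace X] [MulAction Γ X]
    (F : Finset Γ) (δ : ℝ) (Y : Set X) : Prop :=
  ∀ x ∈ Y, ∀ y ∈ Y, x ≠ y → ∃ g ∈ F, δ ≤ dist (g • x) (g • y)

/-- The maximal cardinality of an `(F, δ)`-separated set. -/
def sepCard {Γ : Type*} (X : Type*) [Group Γ] [MetricSpace X] [MulAction Γ X]
    (F : Finset Γ) (δ : ℝ) : ℕ∞ :=
  ⨆ (Y : Finset X) (_ : IsFSeparated F δ (Y : Set X)), (Y.card : ℕ∞)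

/-- Topological entropy of an action, computed along a left Følner sequence `F`:
`sup_{δ > 0} limsup_n (1 / |F n|) log sep(F n, δ)`. -/
def topEntropy {Γ : Type*} (X : Type*) [Group Γ] [MetricSpace X] [MulAction Γ X]
    (F : ℕ → Finset Γ) : EReal :=
  ⨆ (δ : ℝ) (_ : 0 < δ),
    limsup (fun n => ENNReal.log (sepCard X (F n) δ : ENNReal) / ((F n).card : EReal)) atTop

/-! ### Homoclinic points of an action by automorphisms -/

/-- For an action by automorphisms, `x` is homoclinic (asymptotic to the identity) iff
`g x → 1` as `g → ∞`. -/
theorem isAsymptoticPair_one_iff {Γ X : Type*} [Group Γ] [CommGroup X] [MetricSpace X]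
    [MulDistribMulAction Γ X] (x : X) :
    IsAsymptoticPair Γ x 1 ↔ Tendsto (fun g : Γ => g • x) cofinite (𝓝 1) := by
  simp only [IsAsymptoticPair, smul_one]
  exact tendsto_iff_dist_tendsto_zero.symm

/-- The homoclinic group: all `x` such that `(x, 1)` is an asymptotic pair. -/
def homoclinicGroup (Γ X : Type*) [Group Γ] [CommGroup X] [MetricSpace X]
    [IsTopologicalGroup X] [MulDistribMulAction Γ X] : Subgroup X where
  carrier := {x | IsAsymptoticPair Γ x 1}
  one_mem' := by
    simp [isAsymptoticPair_one_iff, tendsto_const_nhds]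
  mul_mem' := by
    intro a b ha hb
    simp only [Set.mem_ofPred_eq, isAsymptoticPair_one_iff, smul_mul'] at ha hb ⊢
    simpa using ha.mul hb
  inv_mem' := by
    intro a ha
    simp only [Set.mem_ofPred_eq, isAsymptoticPair_one_iff, smul_inv'] at ha ⊢
    simpa using ha.inv

/-! ### Principal algebraic actions -/

/-- The left `ℤΓ`-module `ℤΓ / ℤΓ f`, where `ℤΓ f` is the left ideal generated by `f`. -/
def PrincipalModule {Γ : Type*} [Group Γ] (f : MonoidAlgebra ℤ Γ) : Type _ :=
  MonoidAlgebra ℤ Γ ⧸ Submodule.span (MonoidAlgebra ℤ Γ) {f}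

namespace PrincipalModule

variable {Γ : Type*} [Group Γ] (f : MonoidAlgebra ℤ Γ)

instance : AddCommGroup (PrincipalModule f) :=
  inferInstanceAs
    (AddCommGroup (MonoidAlgebra ℤ Γ ⧸ Submodule.span (MonoidAlgebra ℤ Γ) {f}))

instance : Module (MonoidAlgebra ℤ Γ) (PrincipalModule f) :=
  inferInstanceAs
    (Module (MonoidAlgebra ℤ Γ)
      (MonoidAlgebra ℤ Γ ⧸ Submodule.span (MonoidAlgebra ℤ Γ) {f}))

/-- The module carries the discrete topology. -/
instance : TopologicalSpace (PrincipalModule f) := ⊥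

instance : DiscreteTopology (PrincipalModule f) := ⟨rfl⟩

end PrincipalModule

/-- The compact abelian group `X_f`: the Pontryagin dual of the discrete abelian group
`ℤΓ / ℤΓ f`, written multiplicatively. -/
def PrincipalDual {Γ : Type*} [Group Γ] (f : MonoidAlgebra ℤ Γ) : Type _ :=
  PontryaginDual (Multiplicative (PrincipalModule f))

namespace PrincipalDual

variable {Γ : Type*} [Group Γ] (f : MonoidAlgebra ℤ Γ)

instance : CommGroup (PrincipalDual f) :=
  inferInstanceAs (CommGroup (PontryaginDual (Multiplicative (PrincipalModule f))))

instance : TopologicalSpace (PrincipalDual f) :=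
  inferInstanceAs (TopologicalSpace (PontryaginDual (Multiplicative (PrincipalModule f))))

instance : IsTopologicalGroup (PrincipalDual f) :=
  inferInstanceAs (IsTopologicalGroup (PontryaginDual (Multiplicative (PrincipalModule f))))

instance : CompactSpace (PrincipalDual f) :=
  inferInstanceAs (CompactSpace (PontryaginDual (Multiplicative (PrincipalModule f))))

variable {f}

/-- The value of the character `χ` at the element `m` of `ℤΓ / ℤΓ f`. -/
def eval (χ : PrincipalDual f) (m : PrincipalModule f) : Circle :=
  (show Multiplicative (PrincipalModule f) →ₜ* Circle from χ) (Multiplicative.ofAdd m)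

theorem ext' {χ ψ : PrincipalDual f} (h : ∀ m, eval χ m = eval ψ m) : χ = ψ :=
  PontryaginDual.ext (fun a => h a.toAdd)

/-- The action of `Γ` on `X_f` dual to the action on `ℤΓ / ℤΓ f`: `(g χ)(m) = χ(g⁻¹ m)`. -/
instance : SMul Γ (PrincipalDual f) where
  smul g χ :=
    ({ toFun := fun a => eval χ (MonoidAlgebra.of ℤ Γ g⁻¹ • a.toAdd)
       map_one' := by
        rw [toAdd_one, smul_zero]
        exact map_one (show Multiplicative (PrincipalModule f) →ₜ* Circle from χ)
       map_mul' := by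
        intro a b
        rw [toAdd_mul, smul_add]
        exact map_mul (show Multiplicative (PrincipalModule f) →ₜ* Circle from χ) _ _
       continuous_toFun := continuous_of_discreteTopology } :
      Multiplicative (PrincipalModule f) →ₜ* Circle)

theorem smul_eval (g : Γ) (χ : PrincipalDual f) (m : PrincipalModule f) :
    eval (g • χ) m = eval χ (MonoidAlgebra.of ℤ Γ g⁻¹ • m) := rfl

theorem one_eval (m : PrincipalModule f) : eval (1 : PrincipalDual f) m = 1 := rfl

theorem mul_eval (χ ψ : PrincipalDual f) (m : PrincipalModule f) :
    eval (χ * ψ) m = eval χ m * eval ψ m := rfl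

/-- The principal algebraic action of `Γ` on `X_f` by automorphisms. -/
instance : MulDistribMulAction Γ (PrincipalDual f) where
  one_smul χ := ext' fun m => by rw [smul_eval, inv_one, map_one, one_smul]
  mul_smul g h χ := ext' fun m => by
    rw [smul_eval, smul_eval, smul_eval, mul_inv_rev, map_mul, mul_smul]
  smul_one g := ext' fun m => by rw [smul_eval, one_eval, one_eval]
  smul_mul g χ ψ := ext' fun m => by simp only [smul_eval, mul_eval]

end PrincipalDual

/-- An action of `Γ` by automorphisms on a topological group `X` is a principal algebraic action
if for some `f ∈ ℤΓ` it is identified, by an equivariant isomorphism of topological groups, with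
the dual action on `X_f`. -/
def IsPrincipalAlgebraicAction (Γ X : Type*) [Group Γ] [CommGroup X] [TopologicalSpace X]
    [MulDistribMulAction Γ X] : Prop :=
  ∃ (f : MonoidAlgebra ℤ Γ) (φ : X ≃ₜ* PrincipalDual f), ∀ (g : Γ) (x : X), φ (g • x) = g • φ x

end

/-!
Let the action of `Γ` on `X` be isomorphic to that on `X_f`. A point of `X_f` is a function
`x : Γ → ℝ/ℤ` with `∑ f_s x(hs) = 0` for every `h`.

*Expansive actions.* A bounded real function `v ≠ 0` with `∑ f_s v(hs) = 0` for every `h` would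
contradict expansiveness: `t v` modulo `ℤ`, for small `t`, is a point whose whole orbit is close to
the identity (`IsExpansive.eq_zero_of_bounded`). By Hahn–Banach in `ℓ¹(Γ)`, the absence of such `v`
gives `a ∈ ℝΓ` with `‖a f - 1‖₁ < 1`, so convolution by `f` on `ℓ²(Γ)` has a left inverse `W`
commuting with right translations (`exists_left_inverse_regularRep`). The algebra of operators
commuting with right translations is directly finite, by Kaplansky's trace argument, whence
`u = W δ₁` satisfies `f u = δ₁` (`apply_apply_deltaOne_of_mul_eq_one`).

*The homoclinic point.* With `v(k) = u(k⁻¹)` one has `∑ f_s v(hs) ∈ {0, 1}`, so `v` modulo `ℤ` is a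
point of `X_f`, and it is homoclinic because `u ∈ ℓ²(Γ)` vanishes at infinity. If it were the
identity, `u` would be integer-valued, hence finitely supported, and would be an inverse of `f` in
`ℤΓ`; then `X_f` would be trivial (`IsExpansive.exists_homoclinic`). A trivial group has entropy
zero, so positive entropy excludes this.

*Asymptotic pairs.* On a compact group division is uniformly continuous, so `(x, y)` asymptotic
implies `x / y` homoclinic (`IsAsymptoticPair.div`), which gives the equivalence of the two
conclusions.
-/

noncomputable section

/-! ### Translations of `ℓ²(Γ)` -/

section Regular

variable {Γ : Type*} [Group Γ]

/-- The real Hilbert space `ℓ²(Γ)`. -/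
abbrev EllTwo (Γ : Type*) : Type _ := lp (fun _ : Γ => ℝ) 2

theorem memℓp_two_comp_equiv {ι : Type*} (e : ι ≃ ι) (u : EllTwo ι) :
    Memℓp (fun k => u (e k)) 2 := by
  have h := (lp.memℓp u).summable (by norm_num)
  exact memℓp_gen ((e.summable_iff (f := fun i => ‖u i‖ ^ (2 : ENNReal).toReal)).2 h)

/-- Composition with a permutation of the index set, as a linear isometry of `ℓ²`. -/
def reindex {ι : Type*} (e : ι ≃ ι) : EllTwo ι →ₗᵢ[ℝ] EllTwo ι where
  toFun u := ⟨fun k => u (e k), memℓp_two_comp_equiv e u⟩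
  map_add' _ _ := rfl
  map_smul' _ _ := rfl
  norm_map' u := by
    rw [lp.norm_eq_tsum_rpow (by norm_num), lp.norm_eq_tsum_rpow (by norm_num)]
    congr 1
    exact e.tsum_eq (fun i => ‖u i‖ ^ (2 : ENNReal).toReal)

theorem reindex_apply {ι : Type*} (e : ι ≃ ι) (u : EllTwo ι) (k : ι) :
    reindex e u k = u (e k) := rfl

/-- The left regular representation of `Γ` on `ℓ²(Γ)`: `(λ_g u)(k) = u(g⁻¹ k)`. -/
def leftRegular (Γ : Type*) [Group Γ] : Γ →* (EllTwo Γ →L[ℝ] EllTwo Γ) where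
  toFun g := (reindex (Equiv.mulLeft g⁻¹)).toContinuousLinearMap
  map_one' := by
    ext u k
    simp [reindex_apply]
  map_mul' g h := by
    ext u k
    simp [reindex_apply]

theorem leftRegular_apply (g : Γ) (u : EllTwo Γ) (k : Γ) :
    leftRegular Γ g u k = u (g⁻¹ * k) := rfl

/-- Right translation on `ℓ²(Γ)`: `(ρ_g u)(k) = u(k g)`. -/
def rightTranslation (g : Γ) : EllTwo Γ →L[ℝ] EllTwo Γ :=
  (reindex (Equiv.mulRight g)).toContinuousLinearMap

theorem rightTranslation_apply (g : Γ) (u : EllTwo Γ) (k : Γ) :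
    rightTranslation g u k = u (k * g) := rfl

theorem norm_leftRegular_le (g : Γ) : ‖leftRegular Γ g‖ ≤ 1 :=
  LinearIsometry.norm_toContinuousLinearMap_le _

open Classical in
/-- The unit vector of `ℓ²(Γ)` at the identity of `Γ`. -/
def deltaOne (Γ : Type*) [Group Γ] : EllTwo Γ := lp.single 2 1 1

open Classical in
theorem deltaOne_apply (k : Γ) : deltaOne Γ k = if k = 1 then 1 else 0 := by
  rw [deltaOne, lp.single_apply, Pi.single_apply]

theorem norm_deltaOne : ‖deltaOne Γ‖ = 1 := by
  classical
  rw [deltaOne, lp.norm_single (by norm_num), norm_one]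

theorem inner_deltaOne (u : EllTwo Γ) : inner ℝ (deltaOne Γ) u = u 1 := by
  classical
  rw [deltaOne, lp.inner_single_left]
  simp

theorem inner_rightTranslation_deltaOne (g : Γ) (u : EllTwo Γ) :
    inner ℝ (rightTranslation g⁻¹ (deltaOne Γ)) u = u g := by
  have h : u g = rightTranslation g u 1 := by rw [rightTranslation_apply, one_mul]
  rw [h, ← inner_deltaOne, lp.inner_eq_tsum, lp.inner_eq_tsum]
  rw [← (Equiv.mulRight g).tsum_eq]
  simp [rightTranslation_apply]

theorem inner_rightTranslation_left (g : Γ) (u v : EllTwo Γ) :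
    inner ℝ (rightTranslation g u) v = inner ℝ u (rightTranslation g⁻¹ v) := by
  rw [lp.inner_eq_tsum, lp.inner_eq_tsum, ← (Equiv.mulRight g⁻¹).tsum_eq]
  simp [rightTranslation_apply]

/-! ### The trace and one-sided inverses -/

/-- An operator of `ℓ²(Γ)` is right-equivariant if it commutes with all right translations. -/
def IsRightEquivariant (T : EllTwo Γ →L[ℝ] EllTwo Γ) : Prop :=
  ∀ g : Γ, Commute (rightTranslation g) T

theorem IsRightEquivariant.mul {S T : EllTwo Γ →L[ℝ] EllTwo Γ}
    (hS : IsRightEquivariant S) (hT : IsRightEquivariant T) : IsRightEquivariant (S * T) :=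
  fun g => (hS g).mul_right (hT g)

theorem IsRightEquivariant.apply_comm {T : EllTwo Γ →L[ℝ] EllTwo Γ}
    (hT : IsRightEquivariant T) (g : Γ) (u : EllTwo Γ) :
    T (rightTranslation g u) = rightTranslation g (T u) :=
  (DFunLike.congr_fun (hT g).eq u).symm

/-- The trace `T ↦ ⟨δ₁, T δ₁⟩` of a product, as a sum over the group. -/
theorem IsRightEquivariant.mul_deltaOne_one {S T : EllTwo Γ →L[ℝ] EllTwo Γ}
    (hS : IsRightEquivariant S) :
    (S * T) (deltaOne Γ) 1 = ∑' g, S (deltaOne Γ) g⁻¹ * T (deltaOne Γ) g := by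
  change S (T (deltaOne Γ)) 1 = _
  rw [← inner_deltaOne, ← ContinuousLinearMap.adjoint_inner_left, lp.inner_eq_tsum]
  refine tsum_congr fun g => ?_
  have h : (ContinuousLinearMap.adjoint S) (deltaOne Γ) g = S (deltaOne Γ) g⁻¹ := by
    rw [← inner_rightTranslation_deltaOne, ContinuousLinearMap.adjoint_inner_right,
      hS.apply_comm, real_inner_comm, inner_deltaOne, rightTranslation_apply, one_mul]
  rw [h]
  simp [mul_comm]

theorem trace_mul_comm {S T : EllTwo Γ →L[ℝ] EllTwo Γ}
    (hS : IsRightEquivariant S) (hT : IsRightEquivariant T) :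
    (S * T) (deltaOne Γ) 1 = (T * S) (deltaOne Γ) 1 := by
  rw [hS.mul_deltaOne_one, hT.mul_deltaOne_one, ← (Equiv.inv Γ).tsum_eq]
  simp [mul_comm]

theorem IsRightEquivariant.starProjection {K : Submodule ℝ (EllTwo Γ)}
    [K.HasOrthogonalProjection] (hK : ∀ (g : Γ), ∀ u ∈ K, rightTranslation g u ∈ K) :
    IsRightEquivariant K.starProjection := by
  intro g
  ext1 u
  symm
  refine Submodule.eq_starProjection_of_mem_of_inner_eq_zero
    (hK g _ (K.starProjection_apply_mem u)) fun w hw => ?_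
  change inner ℝ (rightTranslation g u - rightTranslation g (K.starProjection u)) w = 0
  rw [← map_sub, inner_rightTranslation_left]
  exact K.starProjection_inner_eq_zero u _ (hK g⁻¹ w hw)

/-- Direct finiteness of the algebra of right-equivariant operators, applied to `δ₁`. With
`E = F W` the idempotent onto the range of `F` and `P` the orthogonal projection onto it,
`P E = E` and `E P = P`, so `P` has the trace of `E`, which is the trace `1` of `W F`. A projection
of trace `1` fixes `δ₁`. -/
theorem apply_apply_deltaOne_of_mul_eq_one {W F : EllTwo Γ →L[ℝ] EllTwo Γ}
    (hW : IsRightEquivariant W) (hF : IsRightEquivariant F) (h : W * F = 1) :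
    F (W (deltaOne Γ)) = deltaOne Γ := by
  have hWF : ∀ u, W (F u) = u := fun u => DFunLike.congr_fun h u
  -- The range of `F` is closed, being the fixed space of `F W`.
  have hclosed : IsClosed (LinearMap.range (F : EllTwo Γ →ₗ[ℝ] EllTwo Γ) :
      Set (EllTwo Γ)) := by
    have : (LinearMap.range (F : EllTwo Γ →ₗ[ℝ] EllTwo Γ) :
        Set (EllTwo Γ)) = {u | F (W u) = u} := by
      ext u
      constructor
      · rintro ⟨y, rfl⟩
        exact congrArg F (hWF y)
      · intro hu
        exact ⟨W u, hu⟩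
    rw [this]
    exact isClosed_eq (by fun_prop) continuous_id
  set K := LinearMap.range (F : EllTwo Γ →ₗ[ℝ] EllTwo Γ)
  have : CompleteSpace K := hclosed.completeSpace_coe
  have hP : IsRightEquivariant K.starProjection := by
    refine IsRightEquivariant.starProjection fun g u hu => ?_
    obtain ⟨y, rfl⟩ := hu
    exact ⟨rightTranslation g y, hF.apply_comm g y⟩
  have hEP : F * W * K.starProjection = K.starProjection := by
    ext1 u
    obtain ⟨y, hy⟩ := K.starProjection_apply_mem u
    change F (W (K.starProjection u)) = K.starProjection u
    rw [← hy]
    exact congrArg F (hWF y)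
  have hPE : K.starProjection * (F * W) = F * W := by
    ext1 u
    exact Submodule.starProjection_eq_self_iff.2 ⟨W u, rfl⟩
  have htrace : K.starProjection (deltaOne Γ) 1 = 1 := by
    rw [← hEP, trace_mul_comm (hF.mul hW) hP, hPE, trace_mul_comm hF hW, h]
    simp [deltaOne_apply]
  have hfix : K.starProjection (deltaOne Γ) = deltaOne Γ := by
    have hinner : inner ℝ (deltaOne Γ) (K.starProjection (deltaOne Γ)) = 1 := by
      rw [inner_deltaOne, htrace]
    have hle : ‖K.starProjection (deltaOne Γ)‖ ≤ 1 := by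
      simpa [norm_deltaOne] using K.norm_starProjection_apply_le (deltaOne Γ)
    have hsq := norm_sub_sq_real (deltaOne Γ) (K.starProjection (deltaOne Γ))
    rw [hinner, norm_deltaOne] at hsq
    have : ‖deltaOne Γ - K.starProjection (deltaOne Γ)‖ ^ 2 ≤ 0 := by
      nlinarith [norm_nonneg (K.starProjection (deltaOne Γ))]
    have h0 : ‖deltaOne Γ - K.starProjection (deltaOne Γ)‖ = 0 := by
      nlinarith [norm_nonneg (deltaOne Γ - K.starProjection (deltaOne Γ))]
    exact (sub_eq_zero.1 (norm_eq_zero.1 h0)).symm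
  have := DFunLike.congr_fun hEP (deltaOne Γ)
  change F (W (K.starProjection (deltaOne Γ))) = _ at this
  rwa [hfix] at this

end Regular

section GroupAlgebra

variable {Γ : Type*} [Group Γ]

/-! ### Group algebras acting on `ℓ²(Γ)` and embedded in `ℓ¹(Γ)` -/

/-- The left regular representation of the real group algebra on `ℓ²(Γ)`. -/
def regularRep (Γ : Type*) [Group Γ] :
    MonoidAlgebra ℝ Γ →ₐ[ℝ] (EllTwo Γ →L[ℝ] EllTwo Γ) :=
  MonoidAlgebra.lift ℝ _ Γ (leftRegular Γ)

theorem regularRep_single (g : Γ) (r : ℝ) :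
    regularRep Γ (MonoidAlgebra.single g r) = r • leftRegular Γ g := by
  simp [regularRep]

theorem isRightEquivariant_regularRep (a : MonoidAlgebra ℝ Γ) :
    IsRightEquivariant (regularRep Γ a) := by
  intro h
  induction a using MonoidAlgebra.induction_linear with
  | zero => simp
  | add a b ha hb => simpa using ha.add_right hb
  | single g r =>
    rw [regularRep_single]
    refine Commute.smul_right ?_ r
    ext u k
    change u (g⁻¹ * (k * h)) = u (g⁻¹ * k * h)
    rw [mul_assoc]

open Classical in
theorem regularRep_deltaOne (a : MonoidAlgebra ℝ Γ) (k : Γ) :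
    regularRep Γ a (deltaOne Γ) k = a.coeff k := by
  induction a using MonoidAlgebra.induction_linear with
  | zero => simp
  | add a b ha hb => simp [ha, hb]
  | single g r =>
    rw [regularRep_single]
    change r * deltaOne Γ (g⁻¹ * k) = _
    rw [deltaOne_apply, MonoidAlgebra.coeff_single, Finsupp.single_apply]
    simp [inv_mul_eq_one]

theorem regularRep_deltaOne_injective {a b : MonoidAlgebra ℝ Γ}
    (h : regularRep Γ a (deltaOne Γ) = regularRep Γ b (deltaOne Γ)) : a = b := by
  apply MonoidAlgebra.coeff_injective
  ext k
  rw [← regularRep_deltaOne, ← regularRep_deltaOne, h]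

/-- The pairing `⟨v, a⟩ = ∑ a_s v(s)` of a function on `Γ` with the group algebra. -/
def pairing {ι : Type*} (v : ι → ℝ) : MonoidAlgebra ℝ ι →+ ℝ where
  toFun a := a.coeff.sum fun s r => r * v s
  map_zero' := by simp
  map_add' a b := by
    rw [MonoidAlgebra.coeff_add]
    exact Finsupp.sum_add_index' (by simp) (by intros; ring)

theorem pairing_single {ι : Type*} (v : ι → ℝ) (s : ι) (r : ℝ) :
    pairing v (MonoidAlgebra.single s r) = r * v s := by
  exact Finsupp.sum_single_index (h := fun s r => r * v s) (zero_mul _)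

/-- Pairing `k ↦ u(k⁻¹)` with `h a` reads off a value of the convolution `a * u`. -/
theorem pairing_inv_single_mul (u : EllTwo Γ) (h : Γ) (a : MonoidAlgebra ℝ Γ) :
    pairing (fun k => u k⁻¹) (MonoidAlgebra.single h 1 * a) = regularRep Γ a u h⁻¹ := by
  induction a using MonoidAlgebra.induction_linear with
  | zero => simp
  | add a b ha hb => simp [mul_add, ha, hb]
  | single g r =>
    rw [MonoidAlgebra.single_mul_single, pairing_single, regularRep_single]
    simp [leftRegular_apply]

/-- The inclusion of the real group algebra in `ℓ¹(Γ)`. -/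
def toEllOne (Γ : Type*) : MonoidAlgebra ℝ Γ →ₗ[ℝ] lp (fun _ : Γ => ℝ) 1 :=
  open Classical in
  (Finsupp.lsum ℝ fun s => lp.lsingle 1 s) ∘ₗ (MonoidAlgebra.coeffLinearEquiv ℝ).toLinearMap

open Classical in
theorem toEllOne_apply {ι : Type*} (a : MonoidAlgebra ℝ ι) :
    toEllOne ι a = a.coeff.sum fun s r => lp.single 1 s r := by
  rfl

theorem norm_toEllOne {ι : Type*} (a : MonoidAlgebra ℝ ι) :
    ‖toEllOne ι a‖ = ∑ s ∈ a.coeff.support, ‖a.coeff s‖ := by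
  classical
  have h := lp.norm_sum_single (p := 1) (by norm_num) (fun s => a.coeff s) a.coeff.support
  rw [toEllOne_apply, Finsupp.sum]
  simpa using h

theorem norm_regularRep_le (a : MonoidAlgebra ℝ Γ) : ‖regularRep Γ a‖ ≤ ‖toEllOne Γ a‖ := by
  rw [norm_toEllOne, regularRep, MonoidAlgebra.lift_apply]
  refine (norm_sum_le _ _).trans (Finset.sum_le_sum fun s _ => ?_)
  rw [norm_smul]
  exact mul_le_of_le_one_right (norm_nonneg _) (norm_leftRegular_le s)

open Classical in
theorem clm_toEllOne {ι : Type*} (φ : lp (fun _ : ι => ℝ) 1 →L[ℝ] ℝ) (a : MonoidAlgebra ℝ ι) :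
    φ (toEllOne ι a) = pairing (fun s => φ (lp.single 1 s 1)) a := by
  rw [toEllOne_apply, Finsupp.sum, map_sum]
  refine Finset.sum_congr rfl fun s _ => ?_
  conv_lhs => rw [← mul_one (a.coeff s), ← smul_eq_mul, lp.single_smul, map_smul, smul_eq_mul]

theorem norm_clm_single_le {ι : Type*} [DecidableEq ι] (φ : lp (fun _ : ι => ℝ) 1 →L[ℝ] ℝ)
    (s : ι) :
    |φ (lp.single 1 s 1)| ≤ ‖φ‖ := by
  simpa [lp.norm_single] using φ.le_opNorm (lp.single 1 s 1)

/-- By Hahn–Banach: if no nonzero bounded function annihilates all translates of `f`, then the left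
ideal generated by `f` comes within `ℓ¹`-distance less than `1` of the identity. -/
theorem exists_norm_toEllOne_mul_sub_one_lt {f : MonoidAlgebra ℝ Γ}
    (hf : ∀ v : Γ → ℝ, (∃ C, ∀ s, |v s| ≤ C) →
      (∀ a, pairing v (a * f) = 0) → v 1 = 0) :
    ∃ a : MonoidAlgebra ℝ Γ, ‖toEllOne Γ (a * f - 1)‖ < 1 := by
  classical
  set S : Submodule ℝ (lp (fun _ : Γ => ℝ) 1) :=
    LinearMap.range (toEllOne Γ ∘ₗ LinearMap.mulRight ℝ f)
  by_cases hmem : toEllOne Γ 1 ∈ S.topologicalClosure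
  · have hmem' : toEllOne Γ 1 ∈ closure (S : Set (lp (fun _ : Γ => ℝ) 1)) := hmem
    obtain ⟨_, ⟨a, rfl⟩, ha⟩ := Metric.mem_closure_iff.1 hmem' 1 one_pos
    refine ⟨a, ?_⟩
    rw [dist_comm, dist_eq_norm] at ha
    simpa [map_sub] using ha
  · exfalso
    obtain ⟨φ, c, hφ, hφ1⟩ := geometric_hahn_banach_closed_point
      (S.topologicalClosure.convex) S.isClosed_topologicalClosure hmem
    -- A functional bounded above on a subspace vanishes there.
    have hzero : ∀ x ∈ S.topologicalClosure, φ x = 0 := by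
      intro x hx
      by_contra hne
      have := hφ _ (S.topologicalClosure.smul_mem ((c + 1) / φ x) hx)
      rw [map_smul, smul_eq_mul, div_mul_cancel₀ _ hne] at this
      linarith
    have hc : 0 < c := by simpa using hφ 0 (zero_mem _)
    have h1 := hf (fun s => φ (lp.single 1 s 1)) ⟨‖φ‖, norm_clm_single_le φ⟩ fun a => by
      rw [← clm_toEllOne]
      exact hzero _ (S.le_topologicalClosure ⟨a, rfl⟩)
    have h2 : φ (toEllOne Γ 1) = φ (lp.single 1 1 1) := by
      rw [clm_toEllOne, MonoidAlgebra.one_def, pairing_single, one_mul]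
    linarith

/-- A left inverse of the convolution operator by `f` on `ℓ²(Γ)` in the right-equivariant
algebra. -/
theorem exists_left_inverse_regularRep {f : MonoidAlgebra ℝ Γ}
    (hf : ∀ v : Γ → ℝ, (∃ C, ∀ s, |v s| ≤ C) →
      (∀ a, pairing v (a * f) = 0) → v 1 = 0) :
    ∃ W : EllTwo Γ →L[ℝ] EllTwo Γ, IsRightEquivariant W ∧ W * regularRep Γ f = 1 := by
  obtain ⟨a, ha⟩ := exists_norm_toEllOne_mul_sub_one_lt hf
  have hnorm : ‖1 - regularRep Γ (a * f)‖ < 1 := by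
    rw [norm_sub_rev, ← map_one (regularRep Γ), ← map_sub]
    exact (norm_regularRep_le _).trans_lt ha
  obtain ⟨V, hV⟩ : IsUnit (regularRep Γ (a * f)) := by
    have := (Units.oneSub _ hnorm).isUnit
    simpa using this
  refine ⟨↑V⁻¹ * regularRep Γ a, fun g => ?_, ?_⟩
  · have hVg : Commute (rightTranslation g) (V : EllTwo Γ →L[ℝ] EllTwo Γ) := by
      rw [hV]
      exact isRightEquivariant_regularRep _ g
    exact hVg.units_inv_right.mul_right (isRightEquivariant_regularRep a g)
  · rw [mul_assoc, ← map_mul, ← hV, Units.inv_mul]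

theorem tendsto_ellTwo_cofinite {ι : Type*} (u : EllTwo ι) : Tendsto (fun k => u k) cofinite (𝓝 0) := by
  have h := ((lp.memℓp u).summable (by norm_num)).tendsto_cofinite_zero
  have h2 := h.sqrt
  simpa [Real.sqrt_sq_eq_abs, tendsto_zero_iff_abs_tendsto_zero, Function.comp_def] using h2

/-! ### Integral elements -/

/-- The inclusion of the integral group ring in the real group algebra. -/
def realCoeff (Γ : Type*) [Group Γ] : MonoidAlgebra ℤ Γ →+* MonoidAlgebra ℝ Γ :=
  MonoidAlgebra.mapRingHom Γ (Int.castRingHom ℝ)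

theorem realCoeff_single (g : Γ) (n : ℤ) :
    realCoeff Γ (MonoidAlgebra.single g n) = MonoidAlgebra.single g (n : ℝ) := by
  simp [realCoeff]

theorem realCoeff_coeff (a : MonoidAlgebra ℤ Γ) (k : Γ) :
    (realCoeff Γ a).coeff k = a.coeff k := by
  simp [realCoeff]

theorem realCoeff_injective : Function.Injective (realCoeff Γ) := by
  intro a b h
  apply MonoidAlgebra.coeff_injective
  ext k
  have := congrArg (fun c => c.coeff k) h
  simpa [realCoeff_coeff] using this

/-- An integer-valued vector of `ℓ²(Γ)` has finite support, hence comes from the integral group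
ring. -/
theorem exists_regularRep_realCoeff_deltaOne {u : EllTwo Γ} (hu : ∀ k, ∃ n : ℤ, u k = n) :
    ∃ b : MonoidAlgebra ℤ Γ, regularRep Γ (realCoeff Γ b) (deltaOne Γ) = u := by
  choose n hn using hu
  have hfin : (Function.support n).Finite := by
    have h := (tendsto_ellTwo_cofinite u).eventually (Metric.ball_mem_nhds 0 one_pos)
    refine Set.Finite.subset (eventually_cofinite.1 h) fun k hk hball => hk ?_
    rw [dist_zero_right, hn, Real.norm_eq_abs] at hball
    exact Int.abs_lt_one_iff.1 (by exact_mod_cast hball)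
  refine ⟨MonoidAlgebra.ofCoeff (Finsupp.ofSupportFinite n hfin), ?_⟩
  ext k
  rw [regularRep_deltaOne, realCoeff_coeff, hn]
  rfl

/-- If `f` acts injectively on `ℓ²(Γ)` then a right inverse of `f` in the integral group ring is
also a left inverse. -/
theorem mul_eq_one_of_left_inverse_regularRep {f b : MonoidAlgebra ℤ Γ}
    {W : EllTwo Γ →L[ℝ] EllTwo Γ} (hW : W * regularRep Γ (realCoeff Γ f) = 1)
    (hfb : f * b = 1) : b * f = 1 := by
  apply realCoeff_injective
  apply regularRep_deltaOne_injective
  rw [← one_mul (regularRep Γ (realCoeff Γ (b * f))), ← hW, mul_assoc, ← map_mul, ← map_mul,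
    ← mul_assoc f, hfb, one_mul, hW, map_one, map_one]

end GroupAlgebra

/-! ### Points of the dual group given by real functions -/

section Dual

variable {Γ : Type*} [Group Γ] {f : MonoidAlgebra ℤ Γ}

/-- The class of an element of `ℤΓ` in `ℤΓ / ℤΓ f`. -/
def principalMk (f a : MonoidAlgebra ℤ Γ) : PrincipalModule f :=
  Submodule.Quotient.mk (p := Submodule.span (MonoidAlgebra ℤ Γ) {f}) a

theorem principalMk_surjective : Function.Surjective (principalMk f) :=
  Submodule.Quotient.mk_surjective _

/-- A real-valued additive function on `ℤΓ` with integral values on `ℤΓ f`, reduced modulo `ℤ`, is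
a point of `X_f`. -/
def torusPoint (ψ : MonoidAlgebra ℤ Γ →+ ℝ) (hψ : ∀ b, ∃ n : ℤ, ψ (b * f) = n) :
    PrincipalDual f :=
  let Ψ : PrincipalModule f →+ Additive Circle :=
    QuotientAddGroup.lift (Submodule.span (MonoidAlgebra ℤ Γ) {f}).toAddSubgroup
      (Real.fourierChar.toAddMonoidHom.comp ψ) (by
        intro x hx
        obtain ⟨b, rfl⟩ := Submodule.mem_span_singleton.1 hx
        obtain ⟨n, hn⟩ := hψ b
        change Real.fourierChar (ψ (b * f)) = 1
        rw [hn, Real.fourierChar_apply', mul_comm, Circle.exp_intCast_mul, Circle.exp_two_pi,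
          one_zpow])
  ({ toMonoidHom := AddMonoidHom.toMultiplicativeLeft Ψ
     continuous_toFun := continuous_of_discreteTopology } :
    Multiplicative (PrincipalModule f) →ₜ* Circle)

theorem torusPoint_eval (ψ : MonoidAlgebra ℤ Γ →+ ℝ) (hψ : ∀ b, ∃ n : ℤ, ψ (b * f) = n)
    (a : MonoidAlgebra ℤ Γ) :
    (torusPoint ψ hψ).eval (principalMk f a) = Real.fourierChar (ψ a) := rfl

theorem smul_torusPoint_eval (ψ : MonoidAlgebra ℤ Γ →+ ℝ)
    (hψ : ∀ b, ∃ n : ℤ, ψ (b * f) = n) (g : Γ) (a : MonoidAlgebra ℤ Γ) :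
    (g • torusPoint ψ hψ).eval (principalMk f a) =
      Real.fourierChar (ψ (MonoidAlgebra.single g⁻¹ 1 * a)) := rfl

/-- The topology of `X_f` is that of pointwise convergence. -/
theorem PrincipalDual.tendsto_one {α : Type*} {l : Filter α} {F : α → PrincipalDual f}
    (h : ∀ a, Tendsto (fun i => (F i).eval (principalMk f a)) l (𝓝 1)) :
    Tendsto F l (𝓝 1) := by
  have hind : IsInducing (fun (χ : Multiplicative (PrincipalModule f) →ₜ* Circle)
      (m : Multiplicative (PrincipalModule f)) => χ m) :=
    ContinuousMap.homeoFnOfDiscrete.isInducing.comp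
      (ContinuousMonoidHom.isInducing_toContinuousMap _ _)
  refine hind.tendsto_nhds_iff.2 (tendsto_pi_nhds.2 fun m => ?_)
  obtain ⟨a, ha⟩ := principalMk_surjective (f := f) m.toAdd
  have := h a
  rw [ha] at this
  exact this

theorem tendsto_fourierChar_one {α : Type*} {l : Filter α} {t : α → ℝ}
    (h : Tendsto t l (𝓝 0)) : Tendsto (fun i => Real.fourierChar (t i)) l (𝓝 1) := by
  have := (Real.continuous_fourierChar.tendsto 0).comp h
  rwa [AddChar.map_zero_eq_one] at this

theorem exists_int_of_fourierChar_eq_one {x : ℝ} (h : Real.fourierChar x = 1) :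
    ∃ n : ℤ, x = n := by
  rw [Real.fourierChar_apply', Circle.exp_eq_one] at h
  obtain ⟨n, hn⟩ := h
  refine ⟨n, ?_⟩
  have : (2 * Real.pi) ≠ 0 := by positivity
  exact mul_left_cancel₀ this (by linarith)

theorem PrincipalDual.subsingleton_of_mul_eq_one {b : MonoidAlgebra ℤ Γ} (h : b * f = 1) :
    Subsingleton (PrincipalDual f) := by
  have hzero : ∀ a, principalMk f a = principalMk f 0 := by
    intro a
    refine (Submodule.Quotient.eq _).2 (Submodule.mem_span_singleton.2 ⟨a * b, ?_⟩)
    rw [smul_eq_mul, mul_assoc, h, mul_one, sub_zero]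
  refine ⟨fun χ ψ => PrincipalDual.ext' fun m => ?_⟩
  obtain ⟨a, rfl⟩ := principalMk_surjective (f := f) m
  rw [hzero]
  exact (map_one (show Multiplicative (PrincipalModule f) →ₜ* Circle from χ)).trans
    (map_one (show Multiplicative (PrincipalModule f) →ₜ* Circle from ψ)).symm

theorem tendsto_pairing_translate {v : Γ → ℝ} (hv : Tendsto v cofinite (𝓝 0))
    (a : MonoidAlgebra ℝ Γ) :
    Tendsto (fun g : Γ => pairing v (MonoidAlgebra.single g⁻¹ 1 * a)) cofinite (𝓝 0) := by
  induction a using MonoidAlgebra.induction_linear with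
  | zero => simpa using tendsto_const_nhds
  | add a b ha hb => simpa [mul_add] using ha.add hb
  | single s r =>
    have hinj : Function.Injective fun g : Γ => g⁻¹ * s := fun g h hgh =>
      inv_injective (mul_right_cancel hgh)
    have := (hv.comp hinj.tendsto_cofinite).const_mul r
    simpa [MonoidAlgebra.single_mul_single, pairing_single] using this

theorem exists_abs_pairing_translate_le {v : Γ → ℝ} (hv : ∃ C, ∀ s, |v s| ≤ C)
    (a : MonoidAlgebra ℝ Γ) :
    ∃ C, ∀ g : Γ, |pairing v (MonoidAlgebra.single g⁻¹ 1 * a)| ≤ C := by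
  induction a using MonoidAlgebra.induction_linear with
  | zero => exact ⟨0, by simp⟩
  | add a b ha hb =>
    obtain ⟨A, hA⟩ := ha
    obtain ⟨B, hB⟩ := hb
    refine ⟨A + B, fun g => ?_⟩
    rw [mul_add, map_add]
    exact (abs_add_le _ _).trans (add_le_add (hA g) (hB g))
  | single s r =>
    obtain ⟨C, hC⟩ := hv
    refine ⟨|r| * C, fun g => ?_⟩
    rw [MonoidAlgebra.single_mul_single, pairing_single, one_mul, abs_mul]
    exact mul_le_mul_of_nonneg_left (hC _) (abs_nonneg r)

end Dual

/-! ### Expansiveness, homoclinic points and entropy -/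

section Dynamics

variable {Γ : Type*} [Group Γ] {X : Type*} [CommGroup X] [MetricSpace X]
  [MulDistribMulAction Γ X]

theorem tendsto_smul_symm {f : MonoidAlgebra ℤ Γ} {φ : X ≃ₜ* PrincipalDual f}
    (hφ : ∀ (g : Γ) (x : X), φ (g • x) = g • φ x) {α : Type*} {l : Filter α} {g : α → Γ}
    {χ : α → PrincipalDual f} (h : Tendsto (fun i => g i • χ i) l (𝓝 1)) :
    Tendsto (fun i => g i • φ.symm (χ i)) l (𝓝 1) := by
  have h' := ((map_continuous φ.symm).tendsto 1).comp h
  rw [map_one] at h'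
  refine h'.congr fun i => ?_
  apply φ.injective
  simp [hφ]

/-- In an expansive action isomorphic to `X_f`, no bounded nonzero real function is annihilated by
`f`: small multiples of such a function would give points of `X_f`, distinct from the identity,
whose whole orbits stay close to the identity. -/
theorem IsExpansive.eq_zero_of_bounded {f : MonoidAlgebra ℤ Γ} (hexp : IsExpansive Γ X)
    (φ : X ≃ₜ* PrincipalDual f) (hφ : ∀ (g : Γ) (x : X), φ (g • x) = g • φ x)
    {v : Γ → ℝ} (hv : ∃ C, ∀ s, |v s| ≤ C)
    (hann : ∀ a, pairing v (a * realCoeff Γ f) = 0) : v 1 = 0 := by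
  by_contra hne
  obtain ⟨η, hη, hsep⟩ := hexp
  -- `t n • v` takes the value `1 / (n + 2)` at the identity: small, and never an integer.
  let t : ℕ → ℝ := fun n => ((n : ℝ) + 2)⁻¹ * (v 1)⁻¹
  have ht : Tendsto t atTop (𝓝 0) := by
    have h1 : Tendsto (fun n : ℕ => (n : ℝ) + 2) atTop atTop :=
      tendsto_atTop_add_const_right _ _ tendsto_natCast_atTop_atTop
    simpa using h1.inv_tendsto_atTop.mul_const (v 1)⁻¹
  let ψ : ℕ → MonoidAlgebra ℤ Γ →+ ℝ := fun n =>
    (AddMonoidHom.mulLeft (t n)).comp ((pairing v).comp (realCoeff Γ).toAddMonoidHom)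
  have hψ_apply : ∀ n a, ψ n a = t n * pairing v (realCoeff Γ a) := fun _ _ => rfl
  have hψ : ∀ n b, ∃ m : ℤ, ψ n (b * f) = m := fun n b => ⟨0, by
    rw [hψ_apply, map_mul, hann, mul_zero, Int.cast_zero]⟩
  let χ : ℕ → PrincipalDual f := fun n => torusPoint (ψ n) (hψ n)
  have htend : Tendsto (fun p : ℕ × Γ => p.2 • χ p.1) (atTop ×ˢ ⊤) (𝓝 1) := by
    refine PrincipalDual.tendsto_one fun a => ?_
    simp only [χ, smul_torusPoint_eval]
    refine tendsto_fourierChar_one ?_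
    obtain ⟨C, hC⟩ := exists_abs_pairing_translate_le hv (realCoeff Γ a)
    have hbound : Tendsto (fun p : ℕ × Γ => |t p.1| * C) (atTop ×ˢ ⊤) (𝓝 0) := by
      have : Tendsto (fun p : ℕ × Γ => t p.1) (atTop ×ˢ ⊤) (𝓝 0) := ht.comp tendsto_fst
      simpa using this.abs.mul_const C
    refine squeeze_zero_norm (fun p => ?_) hbound
    rw [hψ_apply, map_mul, realCoeff_single, Int.cast_one, Real.norm_eq_abs, abs_mul]
    exact mul_le_mul_of_nonneg_left (hC p.2) (abs_nonneg _)
  have htendX : Tendsto (fun p : ℕ × Γ => p.2 • φ.symm (χ p.1)) (atTop ×ˢ ⊤) (𝓝 1) :=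
    tendsto_smul_symm hφ htend
  have hev := htendX.eventually (Metric.ball_mem_nhds 1 hη)
  rw [← principal_univ, eventually_prod_principal_iff] at hev
  obtain ⟨n, hn⟩ := hev.exists
  have hone : φ.symm (χ n) = 1 := by
    by_contra hx
    obtain ⟨g, hg⟩ := hsep _ _ hx
    rw [smul_one] at hg
    exact absurd (hn g (Set.mem_univ g)) (not_lt.2 hg.le)
  have hχ : χ n = 1 := by
    rw [← φ.apply_symm_apply (χ n), hone, map_one]
  have heval := torusPoint_eval (ψ n) (hψ n) (MonoidAlgebra.single 1 1)
  change (χ n).eval _ = _ at heval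
  rw [hχ, PrincipalDual.one_eval] at heval
  obtain ⟨m, hm⟩ := exists_int_of_fourierChar_eq_one heval.symm
  rw [hψ_apply, realCoeff_single, pairing_single, Int.cast_one, one_mul, mul_assoc,
    inv_mul_cancel₀ hne, mul_one] at hm
  have hpos : (0 : ℝ) < ((n : ℝ) + 2)⁻¹ := by positivity
  have hlt : ((n : ℝ) + 2)⁻¹ < 1 := inv_lt_one_of_one_lt₀ (by
    have : (0 : ℝ) ≤ n := n.cast_nonneg
    linarith)
  rw [hm] at hpos hlt
  have h0 : 0 < m := by exact_mod_cast hpos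
  have h1 : m < 1 := by exact_mod_cast hlt
  omega

/-- A nontrivial expansive action isomorphic to `X_f` has a nontrivial homoclinic point, namely the
reduction modulo `ℤ` of the `ℓ²`-inverse of `f`. -/
theorem IsExpansive.exists_homoclinic [Nontrivial X] {f : MonoidAlgebra ℤ Γ}
    (hexp : IsExpansive Γ X)
    (φ : X ≃ₜ* PrincipalDual f) (hφ : ∀ (g : Γ) (x : X), φ (g • x) = g • φ x) :
    ∃ x : X, x ≠ 1 ∧ Tendsto (fun g : Γ => g • x) cofinite (𝓝 1) := by
  obtain ⟨W, hWρ, hW⟩ := exists_left_inverse_regularRep (f := realCoeff Γ f)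
    fun v hv hann => hexp.eq_zero_of_bounded φ hφ hv hann
  have hu := apply_apply_deltaOne_of_mul_eq_one hWρ (isRightEquivariant_regularRep _) hW
  set u := W (deltaOne Γ)
  let v : Γ → ℝ := fun k => u k⁻¹
  have hv : Tendsto v cofinite (𝓝 0) :=
    (tendsto_ellTwo_cofinite u).comp inv_injective.tendsto_cofinite
  let ψ : MonoidAlgebra ℤ Γ →+ ℝ := (pairing v).comp (realCoeff Γ).toAddMonoidHom
  have hψ_apply : ∀ a, ψ a = pairing v (realCoeff Γ a) := fun _ => rfl
  have hψ : ∀ b, ∃ n : ℤ, ψ (b * f) = n := by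
    intro b
    induction b using MonoidAlgebra.induction_linear with
    | zero => exact ⟨0, by simp⟩
    | add a b ha hb =>
      obtain ⟨m, hm⟩ := ha
      obtain ⟨n, hn⟩ := hb
      exact ⟨m + n, by rw [add_mul, map_add, hm, hn, Int.cast_add]⟩
    | single h n =>
      classical
      refine ⟨n * if h⁻¹ = 1 then 1 else 0, ?_⟩
      have h1 : ψ (MonoidAlgebra.single h 1 * f) = if h⁻¹ = 1 then 1 else 0 := by
        rw [hψ_apply, map_mul, realCoeff_single, Int.cast_one, pairing_inv_single_mul, hu,
          deltaOne_apply]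
      have h2 : (MonoidAlgebra.single h n * f : MonoidAlgebra ℤ Γ) =
          n • (MonoidAlgebra.single h 1 * f) := by
        rw [← smul_mul_assoc, MonoidAlgebra.smul_single, smul_eq_mul, mul_one]
      rw [h2, map_zsmul, h1, zsmul_eq_mul]
      push_cast
      rfl
  refine ⟨φ.symm (torusPoint ψ hψ), fun hx => ?_, ?_⟩
  · -- A trivial point comes from an integral `u`, which is then an inverse of `f` in `ℤΓ`.
    have hone : torusPoint ψ hψ = 1 := by
      rw [← φ.apply_symm_apply (torusPoint ψ hψ), hx, map_one]
    have hint : ∀ k, ∃ n : ℤ, u k = n := by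
      intro k
      have heval := torusPoint_eval ψ hψ (MonoidAlgebra.single k⁻¹ 1)
      rw [hone, PrincipalDual.one_eval] at heval
      obtain ⟨n, hn⟩ := exists_int_of_fourierChar_eq_one heval.symm
      rw [hψ_apply, realCoeff_single, pairing_single, Int.cast_one, one_mul] at hn
      exact ⟨n, by simpa [v] using hn⟩
    obtain ⟨b, hb⟩ := exists_regularRep_realCoeff_deltaOne hint
    have hfb : f * b = 1 := by
      apply realCoeff_injective
      apply regularRep_deltaOne_injective
      rw [map_mul, map_mul, map_one, map_one]
      change regularRep Γ (realCoeff Γ f) (regularRep Γ (realCoeff Γ b) (deltaOne Γ)) = deltaOne Γ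
      rw [hb, hu]
    have := PrincipalDual.subsingleton_of_mul_eq_one
      (mul_eq_one_of_left_inverse_regularRep hW hfb)
    exact not_subsingleton X φ.toEquiv.subsingleton
  · have h : Tendsto (fun g : Γ => g • torusPoint ψ hψ) cofinite (𝓝 1) := by
      refine PrincipalDual.tendsto_one fun a => ?_
      simp only [smul_torusPoint_eval, hψ_apply, map_mul, realCoeff_single, Int.cast_one]
      exact tendsto_fourierChar_one (tendsto_pairing_translate hv _)
    exact tendsto_smul_symm hφ h

theorem topEntropy_nonpos_of_subsingleton {Y : Type*} [MetricSpace Y] [MulAction Γ Y]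
    [Subsingleton Y] (F : ℕ → Finset Γ) : topEntropy Y F ≤ 0 := by
  refine iSup₂_le fun δ _ => ?_
  refine limsup_le_of_le (h := Eventually.of_forall fun n => ?_)
  have hcard : sepCard Y (F n) δ ≤ 1 := by
    refine iSup₂_le fun S _ => ?_
    exact_mod_cast Finset.card_le_one_of_subsingleton S
  have hlog : ENNReal.log (sepCard Y (F n) δ : ENNReal) ≤ 0 := by
    rw [← ENNReal.log_one]
    exact ENNReal.log_monotone (by exact_mod_cast hcard)
  exact EReal.div_nonpos_of_nonpos_of_nonneg hlog (by positivity)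

/-- In a compact group the quotient map is uniformly continuous, so the quotient of an asymptotic
pair is homoclinic even if the metric is not invariant. -/
theorem IsAsymptoticPair.div [CompactSpace X] [IsTopologicalGroup X] {x y : X}
    (h : IsAsymptoticPair Γ x y) : IsAsymptoticPair Γ (x / y) 1 := by
  have huc : UniformContinuous fun p : X × X => p.1 / p.2 :=
    CompactSpace.uniformContinuous_of_continuous continuous_div'
  refine Metric.tendsto_nhds.2 fun ε hε => ?_
  obtain ⟨δ, hδ, hdist⟩ := Metric.uniformContinuous_iff.1 huc ε hε
  filter_upwards [Metric.tendsto_nhds.1 h δ hδ] with g hg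
  have := @hdist (g • x, g • y) (g • y, g • y) (by simpa [Prod.dist_eq, hδ] using hg)
  simpa [smul_div'] using this

theorem hasOffDiagonalAsymptoticPair_iff [CompactSpace X] [IsTopologicalGroup X] :
    HasOffDiagonalAsymptoticPair Γ X ↔ homoclinicGroup Γ X ≠ ⊥ := by
  rw [← Subgroup.nontrivial_iff_ne_bot, Subgroup.nontrivial_iff_exists_ne_one]
  constructor
  · rintro ⟨x, y, hxy, h⟩
    exact ⟨x / y, h.div, fun hdiv => hxy (div_eq_one.1 hdiv)⟩
  · rintro ⟨x, hx, hne⟩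
    exact ⟨x, 1, hne, hx⟩

end Dynamics

end

theorem mainTheorem8 {Γ : Type*} [Group Γ] [Countable Γ] (hΓ : IsAmenable Γ)
    {X : Type*} [CommGroup X] [MetricSpace X] [CompactSpace X] [IsTopologicalGroup X]
    [MulDistribMulAction Γ X] [ContinuousConstSMul Γ X]
    (hX : IsPrincipalAlgebraicAction Γ X) :
    (IsExpansive Γ X →
      ∀ F : ℕ → Finset Γ, IsLeftFolner F → 0 < topEntropy X F →
        HasOffDiagonalAsymptoticPair Γ X ∧ homoclinicGroup Γ X ≠ ⊥) ∧
    (HasOffDiagonalAsymptoticPair Γ X ↔ homoclinicGroup Γ X ≠ ⊥) := by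
  refine ⟨fun hexp F _ hent => ?_, hasOffDiagonalAsymptoticPair_iff⟩
  obtain ⟨f, φ, hφ⟩ := hX
  have : Nontrivial X := by
    rw [← not_subsingleton_iff_nontrivial]
    intro hsub
    exact hent.not_ge (topEntropy_nonpos_of_subsingleton F)
  obtain ⟨x, hne, hx⟩ := hexp.exists_homoclinic φ hφ
  have hpair : HasOffDiagonalAsymptoticPair Γ X :=
    ⟨x, 1, hne, (isAsymptoticPair_one_iff x).2 hx⟩
  exact ⟨hpair, hasOffDiagonalAsymptoticPair_iff.1 hpair⟩
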